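/- Let $G=\mathbb{Z}^n$ act on $L^2(\mathbb{R}^n)$ (complex-valued functions) by $(\nu_g\zeta)(x)=\zeta(x-g)$. Let $A\in GL_n(\mathbb{R})$ satisfy $AG\subset G$, let every eigenvalue of $A$ have absolute value $>1$, and assume $|\det A|=2$. Let $U$ be the unitary operator $U\zeta(t)=\sqrt{2}\,\zeta(At)$ on $L^2(\mathbb{R}^n)$, and let $\Lambda$ be the space of compactly supported elements of $L^2(\mathbb{R}^n)$. Let $\mathcal{A}$ be the group algebra of finite linear combinations of the elements $\lambda_g$, $g\in G$, acting on $L^2(\mathbb{R}^n)$ by $\lambda_g\zeta=\nu_g\zeta$. For $\zeta,\eta\in\Lambda$ put $$\langle\zeta,\eta\rangle_{\mathcal A}=\sum_{g\in G}\langle\zeta,\nu_g\eta\rangle\,\lambda_g\in\mathcal A$$ (the sum is finite), where $\langle\cdot,\cdot\rangle$ is linear in the first argument. Two families $\{\zeta_i\}$, $\{\tilde\zeta_i\}$ in a closed subspace $\mathcal K\subset L^2(\mathbb{R}^n)$ are dual frames for $\mathcal K$ if both are frames for $\mathcal K$ and $\zeta=\sum_i\langle\zeta,\zeta_i\rangle\tilde\zeta_i=\sum_i\langle\zeta,\tilde\zeta_i\rangle\zeta_i$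 for every $\zeta\in\mathcal K$; they are bi-orthogonal if moreover $\langle\zeta_i,\tilde\zeta_j\rangle=\delta_{i,j}$. Vectors $\zeta,\tilde\zeta$ form dual (bi-orthogonal) $G$-frames for $\mathcal K$ if $\{\nu_g\zeta\}_{g\in G}$ and $\{\nu_g\tilde\zeta\}_{g\in G}$ form dual (bi-orthogonal) frames for $\mathcal K$. Suppose that $\phi,\tilde\phi\in\Lambda$ and $U$ generate a multiresolution analysis with scaling space $\mathcal V$: that is, $\mathcal V\subset L^2(\mathbb{R}^n)$ is a closed subspace for which $\phi,\tilde\phi$ form dual $G$-frames, $\mathcal V\subset U\mathcal V$, $\bigcup_{k\in\mathbb{Z}}U^k\mathcal V$ is dense in $L^2(\mathbb{R}^n)$, and $\bigcap_{k\in\mathbb{Z}}U^k\mathcal V=\{0\}$. Let $g_1\in G\setminus AG$, and define $$\psi=\langle U\nu_{g_1}\phi,\tilde\phi\rangle_{\mathcal A}\,U\phi-\langle U\phi,\tilde\phi\rangle_{\mathcal A}\,U\nu_{g_1}\phi,$$ $$\tilde\psi=\langle U\nu_{g_1}\tilde\phi,\phi\rangle_{\mathcal A}\,U\tilde\phi-\langle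 U\tilde\phi,\phi\rangle_{\mathcal A}\,U\nu_{g_1}\tilde\phi.$$ Then $\psi,\tilde\psi\in\Lambda\cap U\mathcal V$, and $\psi,\tilde\psi$ are bi-orthogonal MRA wavelets, i.e. they form bi-orthogonal $G$-frames for the wavelet space $U\mathcal V\ominus\mathcal V$ (the orthogonal complement of $\mathcal V$ in $U\mathcal V$). Moreover, let $H\subset GL_n(\mathbb{Z})$ be a finite subgroup affiliated to $A$, i.e. $hA=Ah$ and $(h-I)G\subset AG$ for every $h\in H$. If $\phi(hx)=\phi(x)$ and $\tilde\phi(hx)=\tilde\phi(x)$ for every $h\in H$ and a.e. $x\in\mathbb{R}^n$, then $$\psi(hx+A^{-1}g_1)=\psi(x+A^{-1}g_1)\quad\text{and}\quad\tilde\psi(hx+A^{-1}g_1)=\tilde\psi(x+A^{-1}g_1)$$ for every $h\in H$ and a.e. $x\in\mathbb{R}^n$. -/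

import Mathlib

open MeasureTheory Matrix

noncomputable section

/-! ### Frames in a closed subspace of a Hilbert space -/

section Frames

variable {𝓗 : Type*} [NormedAddCommGroup 𝓗] [InnerProductSpace ℂ 𝓗] {ι : Type*}

/-- The family `ζ` is a frame for the subspace `V`: its members lie in `V`, and for some
`a, b > 0` one has `a ‖ξ‖² ≤ ∑ |⟨ξ, ζ i⟩|² ≤ b ‖ξ‖²` for every `ξ ∈ V`. -/
structure IsFrameFor (V : Submodule ℂ 𝓗) (ζ : ι → 𝓗) : Prop where
  mem : ∀ i, ζ i ∈ V
  summable : ∀ ξ ∈ V, Summable fun i => ‖inner ℂ (ζ i) ξ‖ ^ 2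
  bounds : ∃ a b : ℝ, 0 < a ∧ 0 < b ∧ ∀ ξ ∈ V,
    a * ‖ξ‖ ^ 2 ≤ ∑' i, ‖inner ℂ (ζ i) ξ‖ ^ 2 ∧ ∑' i, ‖inner ℂ (ζ i) ξ‖ ^ 2 ≤ b * ‖ξ‖ ^ 2

/-- Dual frames for `V`: both are frames for `V`, and every `ξ ∈ V` equals
`∑ ⟨ξ, ζ i⟩ ζ' i` and `∑ ⟨ξ, ζ' i⟩ ζ i`. Mathlib's inner product is linear in its second
argument, so `⟨ξ, ζ i⟩` is written `inner ℂ (ζ i) ξ`. -/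
structure IsDualFramesFor (V : Submodule ℂ 𝓗) (ζ ζ' : ι → 𝓗) : Prop where
  frame : IsFrameFor V ζ
  frame_dual : IsFrameFor V ζ'
  expansion : ∀ ξ ∈ V, HasSum (fun i => inner ℂ (ζ i) ξ • ζ' i) ξ
  expansion_dual : ∀ ξ ∈ V, HasSum (fun i => inner ℂ (ζ' i) ξ • ζ i) ξ

/-- Bi-orthogonal dual frames: `⟨ζ i, ζ' j⟩ = δ_{i,j}`. -/
structure IsBiorthogonalFramesFor (V : Submodule ℂ 𝓗) (ζ ζ' : ι → 𝓗) : Prop where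
  dual : IsDualFramesFor V ζ ζ'
  inner_self : ∀ i, inner ℂ (ζ' i) (ζ i) = 1
  inner_ne : ∀ i j, i ≠ j → inner ℂ (ζ' j) (ζ i) = 0

end Frames

/-! ### Translations, the dilation operator and compactly supported elements of `L²(ℝⁿ)` -/

/-- The complex Hilbert space `L²(ℝⁿ)` with Lebesgue measure. -/
abbrev L2 (n : ℕ) : Type := Lp ℂ 2 (volume : Measure (Fin n → ℝ))

/-- The inclusion of `G = ℤⁿ` into `ℝⁿ`. -/
def latticePt {n : ℕ} (g : Fin n → ℤ) : Fin n → ℝ := fun i => (g i : ℝ)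

lemma latticePt_add {n : ℕ} (g h : Fin n → ℤ) :
    latticePt (g + h) = latticePt g + latticePt h := by
  ext i; simp [latticePt]

/-- The translation `(ν_g ζ)(x) = ζ(x - g)`, an isometry of `L²(ℝⁿ)`. -/
def shift {n : ℕ} (g : Fin n → ℤ) : L2 n →ₗᵢ[ℂ] L2 n :=
  Lp.compMeasurePreservingₗᵢ ℂ (fun x => x - latticePt g)
    (measurePreserving_sub_right volume (latticePt g))

lemma shift_coe {n : ℕ} (g : Fin n → ℤ) (ζ : L2 n) :
    ∀ᵐ x, shift g ζ x = ζ (x - latticePt g) :=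
  Lp.coeFn_compMeasurePreserving ζ (measurePreserving_sub_right volume (latticePt g))

lemma shift_zero {n : ℕ} (ζ : L2 n) : shift 0 ζ = ζ := by
  apply Lp.ext
  filter_upwards [shift_coe 0 ζ] with x hx
  rw [hx]
  congr 1
  ext i; simp [latticePt]

lemma shift_add {n : ℕ} (g h : Fin n → ℤ) (ζ : L2 n) :
    shift (g + h) ζ = shift g (shift h ζ) := by
  apply Lp.ext
  filter_upwards [shift_coe (g + h) ζ, shift_coe g (shift h ζ),
    (measurePreserving_sub_right volume (latticePt g)).quasiMeasurePreserving.ae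
      (shift_coe h ζ)] with x h1 h2 h3
  rw [h1, h2, h3, latticePt_add, sub_sub]

lemma measurePreserving_mulVec {n : ℕ} (A : GL (Fin n) ℝ) :
    MeasurePreserving (fun x : Fin n → ℝ => A.1 *ᵥ x) volume
      (ENNReal.ofReal |A.1.det⁻¹| • volume) := by
  have hA : A.1.det ≠ 0 := by
    have := A.det.ne_zero
    simpa using this
  refine ⟨(Continuous.matrix_mulVec continuous_const continuous_id).measurable, ?_⟩
  exact Real.map_matrix_volume_pi_eq_smul_volume_pi hA

lemma quasiMeasurePreserving_mulVec {n : ℕ} (A : GL (Fin n) ℝ) :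
    Measure.QuasiMeasurePreserving (fun x : Fin n → ℝ => A.1 *ᵥ x) volume volume :=
  ⟨(measurePreserving_mulVec A).measurable, by
    rw [(measurePreserving_mulVec A).map_eq]
    exact Measure.smul_absolutelyContinuous⟩

/-- The function `t ↦ √|det A| ζ(A t)`. -/
def dilationFun {n : ℕ} (A : GL (Fin n) ℝ) (ζ : (Fin n → ℝ) → ℂ) : (Fin n → ℝ) → ℂ :=
  (Real.sqrt |A.1.det| : ℂ) • fun t => ζ (A.1 *ᵥ t)

lemma eLpNorm_dilationFun {n : ℕ} (A : GL (Fin n) ℝ) {ζ : (Fin n → ℝ) → ℂ}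
    (hζ : AEStronglyMeasurable ζ) :
    eLpNorm (dilationFun A ζ) 2 volume = eLpNorm ζ 2 volume := by
  have hA : A.1.det ≠ 0 := by
    have := A.det.ne_zero
    simpa using this
  have hpos : 0 < |A.1.det| := abs_pos.mpr hA
  have h1 : eLpNorm (fun t => ζ (A.1 *ᵥ t)) 2 volume =
      eLpNorm ζ 2 (ENNReal.ofReal |A.1.det⁻¹| • volume) :=
    eLpNorm_comp_measurePreserving (p := 2) (g := ζ)
      (hζ.smul_measure _) (measurePreserving_mulVec A)
  rw [dilationFun, eLpNorm_const_smul, h1,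
    eLpNorm_smul_measure_of_ne_top (by simp), smul_eq_mul, ← mul_assoc]
  have h2 : ‖(Real.sqrt |A.1.det| : ℂ)‖ₑ = ENNReal.ofReal (Real.sqrt |A.1.det|) := by
    rw [← ofReal_norm, Complex.norm_real, Real.norm_of_nonneg (Real.sqrt_nonneg _)]
  rw [h2, abs_inv, ENNReal.ofReal_rpow_of_pos (inv_pos.mpr hpos),
    ← ENNReal.ofReal_mul (Real.sqrt_nonneg _)]
  have h3 : Real.sqrt |A.1.det| * |A.1.det|⁻¹ ^ (1 / (2 : ENNReal)).toReal = 1 := by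
    have : (1 / (2 : ENNReal)).toReal = 1 / 2 := by simp
    rw [this, ← Real.sqrt_eq_rpow, Real.sqrt_inv]
    exact mul_inv_cancel₀ (Real.sqrt_pos.mpr hpos).ne'
  rw [h3]; simp

lemma memLp_dilationFun {n : ℕ} (A : GL (Fin n) ℝ) (ζ : L2 n) :
    MemLp (dilationFun A ζ) 2 volume := by
  refine ⟨?_, ?_⟩
  · exact ((Lp.aestronglyMeasurable ζ).comp_quasiMeasurePreserving
      (quasiMeasurePreserving_mulVec A)).const_smul _
  · rw [eLpNorm_dilationFun A (Lp.aestronglyMeasurable ζ)]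
    exact Lp.eLpNorm_lt_top ζ

lemma dilationFun_toLp_coe {n : ℕ} (A : GL (Fin n) ℝ) (ζ : L2 n) :
    ∀ᵐ t, (memLp_dilationFun A ζ).toLp _ t = (Real.sqrt |A.1.det| : ℂ) * ζ (A.1 *ᵥ t) :=
  (memLp_dilationFun A ζ).coeFn_toLp

/-- The dilation `ζ ↦ √|det A| ζ(A ·)` as an isometry of `L²(ℝⁿ)`. -/
def dilationIsom {n : ℕ} (A : GL (Fin n) ℝ) : L2 n →ₗᵢ[ℂ] L2 n where
  toFun ζ := (memLp_dilationFun A ζ).toLp _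
  map_add' ζ η := by
    apply Lp.ext
    filter_upwards [dilationFun_toLp_coe A (ζ + η), dilationFun_toLp_coe A ζ,
      dilationFun_toLp_coe A η, Lp.coeFn_add ((memLp_dilationFun A ζ).toLp _)
        ((memLp_dilationFun A η).toLp _),
      (quasiMeasurePreserving_mulVec A).ae (Lp.coeFn_add ζ η)] with x h1 h2 h3 h4 h5
    rw [h1, h4, Pi.add_apply, h2, h3, h5, Pi.add_apply, mul_add]
  map_smul' c ζ := by
    apply Lp.ext
    filter_upwards [dilationFun_toLp_coe A (c • ζ), dilationFun_toLp_coe A ζ,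
      Lp.coeFn_smul c ((memLp_dilationFun A ζ).toLp _),
      (quasiMeasurePreserving_mulVec A).ae (Lp.coeFn_smul c ζ)] with x h1 h2 h4 h5
    simp only [RingHom.id_apply]
    rw [h1, h4, Pi.smul_apply, h2, h5, Pi.smul_apply, smul_eq_mul, smul_eq_mul]
    ring
  norm_map' ζ := by
    change ‖(memLp_dilationFun A ζ).toLp _‖ = ‖ζ‖
    rw [Lp.norm_toLp, eLpNorm_dilationFun A (Lp.aestronglyMeasurable ζ), Lp.norm_def]

lemma dilationIsom_coe {n : ℕ} (A : GL (Fin n) ℝ) (ζ : L2 n) :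
    ∀ᵐ t, dilationIsom A ζ t = (Real.sqrt |A.1.det| : ℂ) * ζ (A.1 *ᵥ t) :=
  dilationFun_toLp_coe A ζ

lemma dilationIsom_comp {n : ℕ} (A B : GL (Fin n) ℝ) (hAB : A * B = 1) (ζ : L2 n) :
    dilationIsom B (dilationIsom A ζ) = ζ := by
  apply Lp.ext
  have hM : A.1 * B.1 = 1 := by
    have := congrArg Units.val hAB
    simpa using this
  have hdet : |A.1.det| * |B.1.det| = 1 := by
    rw [← abs_mul, ← Matrix.det_mul, hM]; simp
  filter_upwards [dilationIsom_coe B (dilationIsom A ζ),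
    (quasiMeasurePreserving_mulVec B).ae (dilationIsom_coe A ζ)] with t h1 h2
  rw [h1, h2, Matrix.mulVec_mulVec, hM, Matrix.one_mulVec, ← mul_assoc, ← Complex.ofReal_mul,
    ← Real.sqrt_mul (abs_nonneg _), mul_comm, mul_comm |B.1.det|, hdet]
  simp

/-- The unitary operator `(U ζ)(t) = √q ζ(A t)` with `q = |det A|`. -/
def dilation {n : ℕ} (A : GL (Fin n) ℝ) : L2 n ≃ₗᵢ[ℂ] L2 n where
  toLinearEquiv := LinearEquiv.ofLinearMap (dilationIsom A).toLinearMap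
    (dilationIsom A⁻¹).toLinearMap
    (LinearMap.ext fun ζ => dilationIsom_comp A⁻¹ A (inv_mul_cancel A) ζ)
    (LinearMap.ext fun ζ => dilationIsom_comp A A⁻¹ (mul_inv_cancel A) ζ)
  norm_map' ζ := (dilationIsom A).norm_map ζ

lemma dilation_coe {n : ℕ} (A : GL (Fin n) ℝ) (ζ : L2 n) :
    ∀ᵐ t, dilation A ζ t = (Real.sqrt |A.1.det| : ℂ) * ζ (A.1 *ᵥ t) :=
  dilationIsom_coe A ζ

/-- The image `U^k V` of a subspace under an integer power of a unitary operator. -/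
def unitaryImage {n : ℕ} (U : L2 n ≃ₗᵢ[ℂ] L2 n) (k : ℤ) (V : Submodule ℂ (L2 n)) :
    Submodule ℂ (L2 n) :=
  V.map (U ^ k).toLinearEquiv.toLinearMap

/-- The space `Λ` of compactly supported elements of `L²(ℝⁿ)`. -/
def compactSuppL2 (n : ℕ) : Submodule ℂ (L2 n) where
  carrier := {ζ | ∃ K : Set (Fin n → ℝ), IsCompact K ∧ ∀ᵐ x, x ∉ K → ζ x = 0}
  zero_mem' := ⟨∅, isCompact_empty, by
    filter_upwards [Lp.coeFn_zero ℂ 2 (volume : Measure (Fin n → ℝ))] with x hx _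
    exact hx⟩
  add_mem' := by
    rintro ζ η ⟨K, hK, hζ⟩ ⟨L, hL, hη⟩
    refine ⟨K ∪ L, hK.union hL, ?_⟩
    filter_upwards [hζ, hη, Lp.coeFn_add ζ η] with x h1 h2 h3 hx
    rw [Set.mem_union, not_or] at hx
    rw [h3, Pi.add_apply, h1 hx.1, h2 hx.2, add_zero]
  smul_mem' := by
    rintro c ζ ⟨K, hK, hζ⟩
    refine ⟨K, hK, ?_⟩
    filter_upwards [hζ, Lp.coeFn_smul c ζ] with x h1 h2 hx
    rw [h2, Pi.smul_apply, h1 hx, smul_zero]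

lemma shift_mem {n : ℕ} (g : Fin n → ℤ) {ζ : L2 n} (hζ : ζ ∈ compactSuppL2 n) :
    shift g ζ ∈ compactSuppL2 n := by
  obtain ⟨K, hK, h⟩ := hζ
  refine ⟨(fun x => x + latticePt g) '' K, hK.image (by fun_prop), ?_⟩
  filter_upwards [shift_coe g ζ, (measurePreserving_sub_right volume
    (latticePt g)).quasiMeasurePreserving.ae h] with x h1 h2 hx
  rw [h1]
  exact h2 fun hm => hx ⟨_, hm, by simp⟩

lemma dilation_mem {n : ℕ} (A : GL (Fin n) ℝ) {ζ : L2 n} (hζ : ζ ∈ compactSuppL2 n) :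
    dilation A ζ ∈ compactSuppL2 n := by
  obtain ⟨K, hK, h⟩ := hζ
  refine ⟨(fun x => (A⁻¹).1 *ᵥ x) '' K,
    hK.image (Continuous.matrix_mulVec continuous_const continuous_id), ?_⟩
  have hM : (A⁻¹).1 * A.1 = 1 := congrArg Units.val (inv_mul_cancel A)
  filter_upwards [dilation_coe A ζ, (quasiMeasurePreserving_mulVec A).ae h] with x h1 h2 hx
  rw [h1, h2 fun hm => hx ⟨_, hm, ?_⟩, mul_zero]
  change (A⁻¹).1 *ᵥ (A.1 *ᵥ x) = x
  rw [Matrix.mulVec_mulVec, hM, Matrix.one_mulVec]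

/-! ### The group algebra `𝒜`, its action, and the `𝒜`-valued inner product -/

/-- The `*`-algebra `𝒜` of finite linear combinations of the `λ_g`, `g ∈ ℤⁿ`: the group
algebra of `ℤⁿ`, i.e. the Laurent polynomials in `n` variables. -/
abbrev GroupAlg (n : ℕ) : Type := AddMonoidAlgebra ℂ (Fin n → ℤ)

/-- The homomorphism `π₀ : 𝒜 → B(L²(ℝⁿ))` with `π₀(λ_g) = ν_g`. -/
def groupAlgRep (n : ℕ) : GroupAlg n →ₐ[ℂ] (L2 n →L[ℂ] L2 n) :=
  AddMonoidAlgebra.lift ℂ (L2 n →L[ℂ] L2 n) (Fin n → ℤ)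
    { toFun := fun g => (shift g.toAdd).toContinuousLinearMap
      map_one' := by
        ext1 ζ
        exact shift_zero ζ
      map_mul' := fun g h => by
        ext1 ζ
        exact shift_add g.toAdd h.toAdd ζ }

lemma finite_support_inner_shift {n : ℕ} {ζ η : L2 n} (hζ : ζ ∈ compactSuppL2 n)
    (hη : η ∈ compactSuppL2 n) :
    (Function.support fun g : Fin n → ℤ => inner ℂ (shift g η) ζ).Finite := by
  obtain ⟨K, hK, h1⟩ := hζ
  obtain ⟨L, hL, h2⟩ := hη
  obtain ⟨R, hR⟩ := hK.isBounded.exists_norm_le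
  obtain ⟨S, hS⟩ := hL.isBounded.exists_norm_le
  obtain ⟨N, hN⟩ := exists_int_gt (R + S)
  refine (Set.finite_Icc (fun _ : Fin n => -N) (fun _ => N)).subset fun g hg => ?_
  by_contra hgN
  apply hg
  have hdis : ∀ x, x ∈ K → x - latticePt g ∈ L → False := by
    intro x hx hxg
    apply hgN
    have key : ∀ i, |(g i : ℝ)| ≤ N := fun i => by
      have e : (g i : ℝ) = x i - (x - latticePt g) i := by simp [latticePt]
      have b1 := (norm_le_pi_norm x i).trans (hR x hx)
      have b2 := (norm_le_pi_norm (x - latticePt g) i).trans (hS _ hxg)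
      rw [e]
      rw [Real.norm_eq_abs] at b1 b2
      exact (abs_sub _ _).trans (by linarith)
    refine ⟨fun i => ?_, fun i => ?_⟩
    · have := (abs_le.mp (key i)).1
      exact_mod_cast this
    · have := (abs_le.mp (key i)).2
      exact_mod_cast this
  change inner ℂ (shift g η) ζ = 0
  rw [L2.inner_def]
  apply integral_eq_zero_of_ae
  filter_upwards [h1, shift_coe g η, (measurePreserving_sub_right volume
    (latticePt g)).quasiMeasurePreserving.ae h2] with x h1 h2 h3
  by_cases hx : x ∈ K
  · rw [h2, h3 fun hm => hdis x hx hm]; simp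
  · rw [h1 hx]; simp

/-- The `𝒜`-valued inner product `⟨ζ, η⟩_𝒜 = ∑_g ⟨ζ, ν_g η⟩ λ_g` on `Λ`, where `⟨·, ·⟩` is
linear in the first argument. -/
def algInner {n : ℕ} (ζ η : compactSuppL2 n) : GroupAlg n :=
  AddMonoidAlgebra.ofCoeff
    (Finsupp.ofSupportFinite (fun g => inner ℂ (shift g η.1) ζ.1)
      (finite_support_inner_shift ζ.2 η.2))

/-- The translation `ν_g` on `Λ`. -/
def shiftC {n : ℕ} (g : Fin n → ℤ) (ζ : compactSuppL2 n) : compactSuppL2 n :=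
  ⟨shift g ζ.1, shift_mem g ζ.2⟩

/-- The dilation operator `U` on `Λ`. -/
def dilationC {n : ℕ} (A : GL (Fin n) ℝ) (ζ : compactSuppL2 n) : compactSuppL2 n :=
  ⟨dilation A ζ.1, dilation_mem A ζ.2⟩

/-! ### Dilations, multiresolution analyses, wavelets, affiliated groups -/

/-- `A` maps `G = ℤⁿ` into itself and all its complex eigenvalues have modulus `> 1`. -/
structure IsDilationMatrix {n : ℕ} (A : GL (Fin n) ℝ) : Prop where
  lattice : ∀ g : Fin n → ℤ, ∃ g' : Fin n → ℤ, A.1 *ᵥ latticePt g = latticePt g'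
  expanding : ∀ μ : ℂ, Module.End.HasEigenvalue
    (Matrix.toLin' (A.1.map (algebraMap ℝ ℂ))) μ → 1 < ‖μ‖

/-- The vectors `ν_g ζ_i`, `g ∈ ℤⁿ`, generated by a finite family `ζ_1, …, ζ_d`. -/
def shiftFamily {n d : ℕ} (ζ : Fin d → L2 n) : (Fin n → ℤ) × Fin d → L2 n :=
  fun p => shift p.1 (ζ p.2)

/-- The operator `U` of the dilation `A` and the families `φ`, `φ'` generate a multiresolution
analysis with scaling space `V`. -/
structure IsMRA {n d : ℕ} (A : GL (Fin n) ℝ) (φ φ' : Fin d → L2 n)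
    (V : Submodule ℂ (L2 n)) : Prop where
  closed : IsClosed (V : Set (L2 n))
  dual : IsDualFramesFor V (shiftFamily φ) (shiftFamily φ')
  le : V ≤ unitaryImage (dilation A) 1 V
  dense : Dense (⋃ k : ℤ, (unitaryImage (dilation A) k V : Set (L2 n)))
  inter : ⨅ k : ℤ, unitaryImage (dilation A) k V = ⊥

/-- The wavelet space `U V ⊖ V`. -/
def waveletSpace {n : ℕ} (A : GL (Fin n) ℝ) (V : Submodule ℂ (L2 n)) : Submodule ℂ (L2 n) :=
  unitaryImage (dilation A) 1 V ⊓ Vᗮ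

/-- `ψ`, `ψ'` are bi-orthogonal MRA wavelet families for the scaling space `V`: they lie in
`U V` and form bi-orthogonal dual `G`-frames for the wavelet space. -/
structure IsBiorthogonalWavelets {n r : ℕ} (A : GL (Fin n) ℝ) (V : Submodule ℂ (L2 n))
    (ψ ψ' : Fin r → L2 n) : Prop where
  mem : ∀ i, ψ i ∈ unitaryImage (dilation A) 1 V
  mem_dual : ∀ i, ψ' i ∈ unitaryImage (dilation A) 1 V
  biorthogonal : IsBiorthogonalFramesFor (waveletSpace A V) (shiftFamily ψ) (shiftFamily ψ')

/-- An integer matrix regarded as a real matrix. -/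
def realMatrix {n : ℕ} (h : GL (Fin n) ℤ) : Matrix (Fin n) (Fin n) ℝ :=
  h.1.map (Int.cast : ℤ → ℝ)

/-- The finite group `H ⊆ GL_n(ℤ)` is affiliated to `A`: `h A = A h` and `(h - I) G ⊆ A G` for
every `h ∈ H`. -/
structure IsAffiliated {n : ℕ} (H : Subgroup (GL (Fin n) ℤ)) (A : GL (Fin n) ℝ) : Prop where
  finite : Finite H
  comm : ∀ h ∈ H, realMatrix h * A.1 = A.1 * realMatrix h
  trivial_on_quotient : ∀ h ∈ H, ∀ g : Fin n → ℤ, ∃ g' : Fin n → ℤ,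
    (realMatrix h - 1) *ᵥ latticePt g = A.1 *ᵥ latticePt g'

/-- The vector `⟨U ν_{g₁} φ, φ'⟩_𝒜 U φ - ⟨U φ, φ'⟩_𝒜 U ν_{g₁} φ`. -/
def waveletVec {n : ℕ} (A : GL (Fin n) ℝ) (g₁ : Fin n → ℤ) (φ φ' : compactSuppL2 n) :
    L2 n :=
  groupAlgRep n (algInner (dilationC A (shiftC g₁ φ)) φ') (dilation A φ.1) -
    groupAlgRep n (algInner (dilationC A φ) φ') (dilation A (shift g₁ φ.1))

end

/-! The argument is linear algebra of rank two over the group algebra `GroupAlg n`, a commutative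
ring without zero divisors; write `⟨·,·⟩` for `algInner`. Commuting a translation past `U` gives
`ν_k U = U ν_{Ak}`, and `A ℤⁿ` has index `|det A| = 2`, so the translates of `e₁ = Uφ` and `e₂ =
Uν_{g₁}φ` are exactly the vectors `U ν_g φ`. The same holds for `f₁ = Uφ'`, `f₂ = Uν_{g₁}φ'`.

The dual frames `φ, φ'` are automatically bi-orthogonal (`IsMRA.algInner_eq_one`): expanding `φ` in
its own frame gives `⟨φ,φ'⟩φ = φ`, so `⟨φ,φ'⟩` is idempotent, and it is nonzero because `V ≠ 0`.
Hence it is `1`, and consequently `⟨e_i,f_j⟩ = δ_{ij}`.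

Put `a_i = ⟨φ,f_i⟩` and `b_i = ⟨e_i,φ'⟩`. Then `φ = a₁e₁ + a₂e₂` (`scaling_eq`), and pairing with
`φ'` gives `a₁b₁ + a₂b₂ = 1`. The wavelet is `ψ = b₂e₁ - b₁e₂`, so the matrix passing from `(e₁,e₂)`
to `(φ,ψ)` has determinant `-1`. This one identity yields `⟨ψ,φ'⟩ = 0`, `⟨ψ,ψ'⟩ = 1` and the inverse
formulas `e₁ = b₁φ + a₂ψ`, `e₂ = b₂φ - a₁ψ`. By the inverse formulas a vector of `UV` orthogonal to
`V` and to all translates of `ψ` vanishes. Bessel bounds pass from `φ` to `ψ`, a finite combination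
of translates, and `IsBiorthogonalFramesFor.of_separating` turns bi-orthogonality, Bessel bounds and
separation into frames.

For the symmetry, write `hg₁ = g₁ + Ak`. The operator taking `ζ` to `ζ(hx - k)` fixes `ψ`, because
it permutes the terms of each of the two sums defining it; and `A⁻¹g₁` is the fixed point of `x ↦ hx
- k`. -/

noncomputable section

/-! ### A criterion for bi-orthogonal frames -/

section Criterion

variable {𝓗 : Type*} [NormedAddCommGroup 𝓗] [InnerProductSpace ℂ 𝓗] {ι : Type*}

/-- The Bessel condition on the subspace `V`, stated through finite sums. -/
def IsBesselOn (V : Submodule ℂ 𝓗) (x : ι → 𝓗) : Prop :=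
  ∃ b : ℝ, 0 ≤ b ∧ ∀ ξ ∈ V, ∀ s : Finset ι, ∑ i ∈ s, ‖inner ℂ (x i) ξ‖ ^ 2 ≤ b * ‖ξ‖ ^ 2

lemma IsBesselOn.mono {V W : Submodule ℂ 𝓗} {x : ι → 𝓗} (h : IsBesselOn V x) (hW : W ≤ V) :
    IsBesselOn W x := by
  obtain ⟨b, hb0, hb⟩ := h
  exact ⟨b, hb0, fun ξ hξ => hb ξ (hW hξ)⟩

lemma IsFrameFor.isBesselOn {V : Submodule ℂ 𝓗} {x : ι → 𝓗} (h : IsFrameFor V x) :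
    IsBesselOn V x := by
  obtain ⟨a, b, -, hb0, hab⟩ := h.bounds
  exact ⟨b, hb0.le, fun ξ hξ s =>
    ((h.summable ξ hξ).sum_le_tsum s fun i _ => by positivity).trans (hab ξ hξ).2⟩

lemma IsBesselOn.add {V : Submodule ℂ 𝓗} {x y : ι → 𝓗} (hx : IsBesselOn V x)
    (hy : IsBesselOn V y) : IsBesselOn V fun i => x i + y i := by
  obtain ⟨b, hb0, hb⟩ := hx
  obtain ⟨c, hc0, hc⟩ := hy
  refine ⟨2 * b + 2 * c, by positivity, fun ξ hξ s => ?_⟩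
  calc ∑ i ∈ s, ‖inner ℂ (x i + y i) ξ‖ ^ 2
      ≤ ∑ i ∈ s, (2 * ‖inner ℂ (x i) ξ‖ ^ 2 + 2 * ‖inner ℂ (y i) ξ‖ ^ 2) := by
        refine Finset.sum_le_sum fun i _ => ?_
        rw [inner_add_left]
        have h1 := norm_add_le (inner ℂ (x i) ξ) (inner ℂ (y i) ξ)
        have h2 := pow_le_pow_left₀ (norm_nonneg _) h1 2
        nlinarith [sq_nonneg (‖inner ℂ (x i) ξ‖ - ‖inner ℂ (y i) ξ‖)]
    _ = 2 * ∑ i ∈ s, ‖inner ℂ (x i) ξ‖ ^ 2 + 2 * ∑ i ∈ s, ‖inner ℂ (y i) ξ‖ ^ 2 := by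
        rw [Finset.sum_add_distrib, Finset.mul_sum, Finset.mul_sum]
    _ ≤ (2 * b + 2 * c) * ‖ξ‖ ^ 2 := by linarith [hb ξ hξ s, hc ξ hξ s]

lemma IsBesselOn.const_smul {V : Submodule ℂ 𝓗} {x : ι → 𝓗} (hx : IsBesselOn V x) (c : ℂ) :
    IsBesselOn V fun i => c • x i := by
  obtain ⟨b, hb0, hb⟩ := hx
  refine ⟨‖c‖ ^ 2 * b, by positivity, fun ξ hξ s => ?_⟩
  simp only [inner_smul_left, norm_mul, RCLike.norm_conj, mul_pow]
  rw [← Finset.mul_sum, mul_assoc]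
  exact mul_le_mul_of_nonneg_left (hb ξ hξ s) (by positivity)

lemma IsBesselOn.comp_injective {κ : Type*} {V : Submodule ℂ 𝓗} {x : ι → 𝓗}
    (hx : IsBesselOn V x) {f : κ → ι} (hf : Function.Injective f) :
    IsBesselOn V fun i => x (f i) := by
  obtain ⟨b, hb0, hb⟩ := hx
  refine ⟨b, hb0, fun ξ hξ s => ?_⟩
  have := hb ξ hξ (s.map ⟨f, hf⟩)
  rwa [Finset.sum_map] at this

/-- The Bessel bound for analysis gives the same bound for synthesis, by duality: pair the sum `y`
with itself, apply Cauchy–Schwarz, and use the Bessel bound at `y`, which lies in `V`. -/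
lemma norm_sum_smul_sq_le {V : Submodule ℂ 𝓗} {x : ι → 𝓗} (hx : ∀ i, x i ∈ V) {b : ℝ}
    (hb0 : 0 ≤ b)
    (hb : ∀ ξ ∈ V, ∀ s : Finset ι, ∑ i ∈ s, ‖inner ℂ (x i) ξ‖ ^ 2 ≤ b * ‖ξ‖ ^ 2)
    (c : ι → ℂ) (s : Finset ι) :
    ‖∑ i ∈ s, c i • x i‖ ^ 2 ≤ b * ∑ i ∈ s, ‖c i‖ ^ 2 := by
  set y := ∑ i ∈ s, c i • x i with hy
  have hyV : y ∈ V := V.sum_mem fun i _ => V.smul_mem _ (hx i)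
  rcases eq_or_ne y 0 with h0 | h0
  · rw [h0, norm_zero, zero_pow two_ne_zero]
    positivity
  · have h1 : ‖y‖ ^ 2 ≤ ∑ i ∈ s, ‖c i‖ * ‖inner ℂ (x i) y‖ := by
      have h2 : inner ℂ y y = ∑ i ∈ s, c i * inner ℂ y (x i) := by
        conv_lhs => rw [hy]; rw [inner_sum]
        simp [inner_smul_right, ← hy]
      rw [← inner_self_eq_norm_sq (𝕜 := ℂ) y]
      refine (RCLike.re_le_norm _).trans ?_
      rw [h2]
      refine (norm_sum_le _ _).trans (Finset.sum_le_sum fun i _ => ?_)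
      rw [norm_mul, norm_inner_symm]
    have h3 := Finset.sum_mul_sq_le_sq_mul_sq s (fun i => ‖c i‖) fun i => ‖inner ℂ (x i) y‖
    have h4 : (‖y‖ ^ 2) ^ 2 ≤ (∑ i ∈ s, ‖c i‖ ^ 2) * (b * ‖y‖ ^ 2) :=
      (pow_le_pow_left₀ (by positivity) h1 2).trans
        (h3.trans (mul_le_mul_of_nonneg_left (hb y hyV s) (by positivity)))
    have h5 : 0 < ‖y‖ ^ 2 := by positivity
    -- Cancel one factor `‖y‖ ^ 2` from `h4`.
    nlinarith

lemma IsBesselOn.summable_sq {V : Submodule ℂ 𝓗} {x : ι → 𝓗} (hx : IsBesselOn V x)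
    {ξ : 𝓗} (hξ : ξ ∈ V) : Summable fun i => ‖inner ℂ (x i) ξ‖ ^ 2 := by
  obtain ⟨b, -, hb⟩ := hx
  exact summable_of_sum_le (fun i => by positivity) (hb ξ hξ)

lemma IsBesselOn.summable_smul [CompleteSpace 𝓗] {V : Submodule ℂ 𝓗} {x : ι → 𝓗}
    (hx : IsBesselOn V x) (hxV : ∀ i, x i ∈ V) {c : ι → ℂ} (hc : Summable fun i => ‖c i‖ ^ 2) :
    Summable fun i => c i • x i := by
  obtain ⟨b, hb0, hb⟩ := hx
  rw [summable_iff_vanishing_norm]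
  intro ε hε
  -- The bound `b` may be zero, hence the denominator `b + 1`.
  obtain ⟨s, hs⟩ := summable_iff_vanishing_norm.mp hc (ε ^ 2 / (b + 1)) (by positivity)
  refine ⟨s, fun t ht => ?_⟩
  have h1 := norm_sum_smul_sq_le hxV hb0 hb c t
  have h2 := hs t ht
  rw [Real.norm_of_nonneg (by positivity), lt_div_iff₀ (by positivity)] at h2
  have h3 : 0 ≤ ∑ i ∈ t, ‖c i‖ ^ 2 := by positivity
  exact lt_of_pow_lt_pow_left₀ 2 hε.le (by nlinarith)

/-- The Bessel conditions make the series converge to some `η`, which lies in the closed `V`. By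
bi-orthogonality `η` and `ξ` have the same coefficients against every `x i`, so separation forces `η
= ξ`. -/
lemma hasSum_of_biorthogonal [CompleteSpace 𝓗] {V : Submodule ℂ 𝓗}
    (hV : IsClosed (V : Set 𝓗)) {x y : ι → 𝓗} (hy : ∀ i, y i ∈ V)
    (hBx : IsBesselOn V x) (hBy : IsBesselOn V y)
    (h1 : ∀ i, inner ℂ (x i) (y i) = 1) (h0 : ∀ i j, i ≠ j → inner ℂ (x i) (y j) = 0)
    (hsep : ∀ ξ ∈ V, (∀ i, inner ℂ (x i) ξ = 0) → ξ = 0) {ξ : 𝓗} (hξ : ξ ∈ V) :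
    HasSum (fun i => inner ℂ (x i) ξ • y i) ξ := by
  obtain ⟨η, hη⟩ := hBy.summable_smul hy (hBx.summable_sq hξ)
  have hηV : η ∈ V := hV.mem_of_tendsto hη
    (Filter.Eventually.of_forall fun s => V.sum_mem fun i _ => V.smul_mem _ (hy i))
  have key : ξ - η = 0 := by
    refine hsep _ (V.sub_mem hξ hηV) fun i => ?_
    have h2 : HasSum (fun j => inner ℂ (x i) (inner ℂ (x j) ξ • y j)) (inner ℂ (x i) η) :=
      (innerSL ℂ (x i)).hasSum hη
    have h3 : HasSum (fun j => inner ℂ (x i) (inner ℂ (x j) ξ • y j)) (inner ℂ (x i) ξ) := by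
      convert hasSum_single i fun j hj => ?_ using 1
      · rw [inner_smul_right, h1, mul_one]
      · rw [inner_smul_right, h0 i j hj.symm, mul_zero]
    rw [inner_sub_right, h3.unique h2, sub_self]
  have h4 := sub_eq_zero.mp key
  subst h4
  exact hη

/-- The upper frame bound is the Bessel bound of `x`; the lower one is the synthesis bound of `y`
applied to the partial sums of the expansion, in the limit. -/
lemma IsFrameFor.of_hasSum {V : Submodule ℂ 𝓗} {x y : ι → 𝓗} (hx : ∀ i, x i ∈ V)
    (hy : ∀ i, y i ∈ V) (hBx : IsBesselOn V x) (hBy : IsBesselOn V y)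
    (h : ∀ ξ ∈ V, HasSum (fun i => inner ℂ (x i) ξ • y i) ξ) : IsFrameFor V x := by
  have hs := fun ξ (hξ : ξ ∈ V) => hBx.summable_sq hξ
  obtain ⟨b, hb0, hb⟩ := hBx
  obtain ⟨c, hc0, hc⟩ := hBy
  refine ⟨hx, hs, (c + 1)⁻¹, b + 1, by positivity, by positivity, fun ξ hξ => ⟨?_, ?_⟩⟩
  · rw [inv_mul_le_iff₀ (by positivity)]
    have h1 : ‖ξ‖ ^ 2 ≤ c * ∑' i, ‖inner ℂ (x i) ξ‖ ^ 2 :=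
      le_of_tendsto_of_tendsto (((h ξ hξ).norm).pow 2) (Filter.Tendsto.const_mul c (hs ξ hξ).hasSum)
        (Filter.Eventually.of_forall fun s => norm_sum_smul_sq_le hy hc0 hc _ s)
    have h2 : 0 ≤ ∑' i, ‖inner ℂ (x i) ξ‖ ^ 2 := tsum_nonneg fun i => by positivity
    linarith
  · have h1 := (hs ξ hξ).tsum_le_of_sum_le (hb ξ hξ)
    nlinarith [sq_nonneg ‖ξ‖]

/-- Two bi-orthogonal Bessel families in a closed subspace that both separate its points are
bi-orthogonal frames. -/
theorem IsBiorthogonalFramesFor.of_separating [CompleteSpace 𝓗] {V : Submodule ℂ 𝓗}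
    (hV : IsClosed (V : Set 𝓗)) {x y : ι → 𝓗} (hx : ∀ i, x i ∈ V) (hy : ∀ i, y i ∈ V)
    (hBx : IsBesselOn V x) (hBy : IsBesselOn V y)
    (h1 : ∀ i, inner ℂ (y i) (x i) = 1) (h0 : ∀ i j, i ≠ j → inner ℂ (y j) (x i) = 0)
    (hsx : ∀ ξ ∈ V, (∀ i, inner ℂ (x i) ξ = 0) → ξ = 0)
    (hsy : ∀ ξ ∈ V, (∀ i, inner ℂ (y i) ξ = 0) → ξ = 0) :
    IsBiorthogonalFramesFor V x y := by
  have e1 : ∀ ξ ∈ V, HasSum (fun i => inner ℂ (x i) ξ • y i) ξ := fun ξ hξ =>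
    hasSum_of_biorthogonal hV hy hBx hBy
      (fun i => by rw [← inner_conj_symm, h1, map_one])
      (fun i j hij => by rw [← inner_conj_symm, h0 i j hij, map_zero]) hsx hξ
  have e2 : ∀ ξ ∈ V, HasSum (fun i => inner ℂ (y i) ξ • x i) ξ := fun ξ hξ =>
    hasSum_of_biorthogonal hV hx hBy hBx h1 (fun i j hij => h0 j i hij.symm) hsy hξ
  exact ⟨⟨.of_hasSum hx hy hBx hBy e1, .of_hasSum hy hx hBy hBx e2, e1, e2⟩, h1, h0⟩

end Criterion

/-! ### The sublattice `A ℤⁿ` -/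

section Lattice

variable {n : ℕ}

lemma latticePt_injective : Function.Injective (latticePt (n := n)) := fun g h hgh => by
  ext i
  have h1 : (g i : ℝ) = h i := congrFun hgh i
  exact_mod_cast h1

lemma latticePt_mulVec (M : Matrix (Fin n) (Fin n) ℤ) (g : Fin n → ℤ) :
    latticePt (M *ᵥ g) = M.map (Int.cast : ℤ → ℝ) *ᵥ latticePt g := by
  ext i
  simp [latticePt, Matrix.mulVec, dotProduct]

/-- A dilation matrix has integer entries. -/
lemma IsDilationMatrix.exists_int {A : GL (Fin n) ℝ} (hA : IsDilationMatrix A) :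
    ∃ M : Matrix (Fin n) (Fin n) ℤ, M.map (Int.cast : ℤ → ℝ) = A.1 := by
  choose f hf using hA.lattice
  -- The columns are the images of the standard basis vectors.
  refine ⟨Matrix.of fun i j => f (Pi.single j 1) i, ?_⟩
  ext i j
  have h1 : latticePt (Pi.single j 1 : Fin n → ℤ) = Pi.single j 1 := by
    ext k
    rcases eq_or_ne k j with rfl | hk
    · simp [latticePt]
    · simp [latticePt, hk]
  have h2 := congrFun (hf (Pi.single j 1)) i
  rw [h1, Matrix.mulVec_single_one] at h2
  simpa [latticePt] using h2.symm

/-- The range of `M` has index `|det M| = 2`, so its only nontrivial coset is that of `g₁`. -/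
lemma exists_coset_of_natAbs_det_eq_two {M : Matrix (Fin n) (Fin n) ℤ}
    (hM : M.det.natAbs = 2) {g₁ : Fin n → ℤ} (hg₁ : ¬ ∃ k, M *ᵥ k = g₁) (g : Fin n → ℤ) :
    (∃ k, g = M *ᵥ k) ∨ ∃ k, g = M *ᵥ k + g₁ := by
  have hinj : Function.Injective M.mulVecLin :=
    Matrix.mulVec_injective_of_det_ne_zero fun h => by simp [h] at hM
  have hcard : Nat.card ((Fin n → ℤ) ⧸ LinearMap.range M.mulVecLin) = 2 := by
    rw [← Submodule.natAbs_det_equiv _ (LinearEquiv.ofInjective M.mulVecLin hinj), ← hM,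
      ← LinearMap.det_toLin']
    rfl
  have hidx : (LinearMap.range M.mulVecLin).toAddSubgroup.index = 2 := hcard
  have hiff := fun a b => AddSubgroup.add_mem_iff_of_index_two hidx (a := a) (b := b)
  have hmem : ∀ a, a ∈ (LinearMap.range M.mulVecLin).toAddSubgroup ↔ ∃ k, M *ᵥ k = a :=
    fun a => Iff.rfl
  by_cases hg : ∃ k, M *ᵥ k = g
  · obtain ⟨k, hk⟩ := hg
    exact Or.inl ⟨k, hk.symm⟩
  · right
    have h1 := hiff (g - g₁) g₁
    rw [sub_add_cancel, hmem, hmem, hmem] at h1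
    have : ∃ k, M *ᵥ k = g - g₁ := by tauto
    obtain ⟨k, hk⟩ := this
    exact ⟨k, by rw [hk, sub_add_cancel]⟩

end Lattice

/-! ### `Λ` as a module over the group algebra -/

section GroupAlgebra

variable {n : ℕ}

lemma shift_comm (g h : Fin n → ℤ) (ζ : L2 n) : shift g (shift h ζ) = shift h (shift g ζ) := by
  rw [← shift_add, add_comm, shift_add]

lemma inner_shift_shift (g h : Fin n → ℤ) (ξ η : L2 n) :
    inner ℂ (shift g ξ) (shift h η) = inner ℂ (shift (g - h) ξ) η := by
  have : shift g ξ = shift h (shift (g - h) ξ) := by rw [← shift_add, add_sub_cancel]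
  rw [this, LinearIsometry.inner_map_map]

lemma groupAlgRep_single (g : Fin n → ℤ) (c : ℂ) (ζ : L2 n) :
    groupAlgRep n (AddMonoidAlgebra.single g c) ζ = c • shift g ζ := by
  rw [groupAlgRep, AddMonoidAlgebra.lift_single]
  rfl

lemma groupAlgRep_mem {W : Submodule ℂ (L2 n)} {ξ : L2 n} (h : ∀ g, shift g ξ ∈ W)
    (a : GroupAlg n) : groupAlgRep n a ξ ∈ W := by
  induction a using AddMonoidAlgebra.induction_linear with
  | zero => simp
  | add a b ha hb => rw [map_add]; exact W.add_mem ha hb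
  | single g c => rw [groupAlgRep_single]; exact W.smul_mem _ (h g)

lemma shift_groupAlgRep (g : Fin n → ℤ) (a : GroupAlg n) (ζ : L2 n) :
    shift g (groupAlgRep n a ζ) = groupAlgRep n a (shift g ζ) := by
  induction a using AddMonoidAlgebra.induction_linear with
  | zero => simp
  | add a b ha hb => simp [map_add, ha, hb]
  | single k c => simp [groupAlgRep_single, shift_comm]

/-- With this structure the identities between scaling functions and wavelets become module algebra
over a commutative ring. -/
instance : Module (GroupAlg n) (compactSuppL2 n) where
  smul a ξ := ⟨groupAlgRep n a ξ.1, groupAlgRep_mem (fun g => shift_mem g ξ.2) a⟩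
  one_smul ξ := Subtype.ext (by change groupAlgRep n 1 ξ.1 = ξ.1; simp)
  mul_smul a b ξ := Subtype.ext (by
    change groupAlgRep n (a * b) ξ.1 = groupAlgRep n a (groupAlgRep n b ξ.1); simp)
  smul_zero a := Subtype.ext (by change groupAlgRep n a 0 = 0; simp)
  smul_add a ξ η := Subtype.ext (by
    change groupAlgRep n a (ξ.1 + η.1) = groupAlgRep n a ξ.1 + groupAlgRep n a η.1; simp)
  add_smul a b ξ := Subtype.ext (by
    change groupAlgRep n (a + b) ξ.1 = groupAlgRep n a ξ.1 + groupAlgRep n b ξ.1; simp)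
  zero_smul ξ := Subtype.ext (by change groupAlgRep n 0 ξ.1 = 0; simp)

lemma coe_groupAlg_smul (a : GroupAlg n) (ξ : compactSuppL2 n) :
    (a • ξ).1 = groupAlgRep n a ξ.1 := rfl

lemma coeff_algInner (ξ η : compactSuppL2 n) (g : Fin n → ℤ) :
    (algInner ξ η).coeff g = inner ℂ (shift g η.1) ξ.1 := rfl

lemma algInner_add_left (ξ ξ' η : compactSuppL2 n) :
    algInner (ξ + ξ') η = algInner ξ η + algInner ξ' η := by
  ext g
  rw [AddMonoidAlgebra.coeff_add, Finsupp.add_apply]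
  simp only [coeff_algInner, Submodule.coe_add, inner_add_right]

/-- It suffices to check single group elements, where both sides are the coefficients of `algInner ξ
η` translated by `k`. -/
lemma algInner_smul_left (a : GroupAlg n) (ξ η : compactSuppL2 n) :
    algInner (a • ξ) η = a * algInner ξ η := by
  induction a using AddMonoidAlgebra.induction_linear with
  | zero =>
    ext g
    rw [zero_smul, zero_mul]
    simp [coeff_algInner]
  | add a b ha hb => rw [add_smul, add_mul, algInner_add_left, ha, hb]
  | single k c =>
    ext g
    rw [AddMonoidAlgebra.coeff_single_mul_eq_mul_coeff (-k + g) fun _ _ => eq_neg_add_iff_add_eq.symm,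
      coeff_algInner, coeff_algInner, coe_groupAlg_smul,
      groupAlgRep_single, inner_smul_right, inner_shift_shift, sub_eq_neg_add]

lemma algInner_neg_left (ξ η : compactSuppL2 n) : algInner (-ξ) η = -algInner ξ η := by
  rw [← neg_one_smul (GroupAlg n), algInner_smul_left, neg_one_mul]

lemma algInner_sub_left (ξ ξ' η : compactSuppL2 n) :
    algInner (ξ - ξ') η = algInner ξ η - algInner ξ' η := by
  rw [sub_eq_add_neg, algInner_add_left, algInner_neg_left, sub_eq_add_neg]

/-- The involution `λ_g ↦ λ_{-g}` of the group algebra, extended conjugate-linearly. -/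
def groupAlgStar (n : ℕ) : GroupAlg n →+* GroupAlg n :=
  (AddMonoidAlgebra.mapRingHom (Fin n → ℤ) (starRingEnd ℂ)).comp
    (AddMonoidAlgebra.mapDomainRingHom ℂ (negAddMonoidHom : (Fin n → ℤ) →+ (Fin n → ℤ)))

lemma coeff_groupAlgStar (a : GroupAlg n) (g : Fin n → ℤ) :
    (groupAlgStar n a).coeff g = starRingEnd ℂ (a.coeff (-g)) := by
  induction a using AddMonoidAlgebra.induction_linear with
  | zero => simp
  | add a b ha hb => simp [ha, hb]
  | single k c =>
    simp [groupAlgStar, Finsupp.single_apply, neg_eq_iff_eq_neg, apply_ite (starRingEnd ℂ)]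

lemma groupAlgStar_algInner (ξ η : compactSuppL2 n) :
    groupAlgStar n (algInner ξ η) = algInner η ξ := by
  ext g
  rw [coeff_groupAlgStar, coeff_algInner, coeff_algInner, inner_conj_symm]
  have := inner_shift_shift 0 (-g) ξ.1 η.1
  rw [shift_zero, zero_sub, neg_neg] at this
  exact this

lemma algInner_smul_right (a : GroupAlg n) (ξ η : compactSuppL2 n) :
    algInner ξ (a • η) = groupAlgStar n a * algInner ξ η := by
  rw [← groupAlgStar_algInner, algInner_smul_left, map_mul, groupAlgStar_algInner]

lemma algInner_sub_right (ξ η η' : compactSuppL2 n) :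
    algInner ξ (η - η') = algInner ξ η - algInner ξ η' := by
  rw [← groupAlgStar_algInner, algInner_sub_left, map_sub, groupAlgStar_algInner,
    groupAlgStar_algInner]

lemma inner_shift_eq_zero_iff (ξ η : compactSuppL2 n) :
    (∀ g, inner ℂ (shift g η.1) ξ.1 = 0) ↔ algInner ξ η = 0 := by
  refine ⟨fun h => ?_, fun h g => ?_⟩
  · ext g
    exact h g
  · rw [← coeff_algInner, h]
    rfl

/-- The bridge from analysis to algebra: a frame series with coefficients from compactly supported
vectors is the action of the element `algInner ξ η`. -/
lemma hasSum_groupAlgRep_algInner (ξ η : compactSuppL2 n) (ζ : L2 n) :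
    HasSum (fun g => inner ℂ (shift g η.1) ξ.1 • shift g ζ)
      (groupAlgRep n (algInner ξ η) ζ) := by
  have h1 : groupAlgRep n (algInner ξ η) ζ =
      ∑ g ∈ (algInner ξ η).coeff.support, inner ℂ (shift g η.1) ξ.1 • shift g ζ := by
    rw [groupAlgRep, AddMonoidAlgebra.lift_apply, Finsupp.sum, _root_.sum_apply]
    rfl
  rw [h1]
  refine hasSum_sum_of_ne_finset_zero fun g hg => ?_
  rw [Finsupp.notMem_support_iff, coeff_algInner] at hg
  rw [hg, zero_smul]

/-- Here `ξ` need not have compact support, so `algInner` is unavailable; instead, the orthogonal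
complement of `ξ` is a subspace containing all translates of `η`. -/
lemma inner_shift_smul_eq_zero {ξ : L2 n} {η : compactSuppL2 n}
    (h : ∀ g, inner ℂ (shift g η.1) ξ = 0) (a : GroupAlg n) (g : Fin n → ℤ) :
    inner ℂ (shift g (a • η).1) ξ = 0 := by
  rw [coe_groupAlg_smul, shift_groupAlgRep]
  have h1 : groupAlgRep n a (shift g η.1) ∈ (ℂ ∙ ξ)ᗮ := groupAlgRep_mem (fun k => by
    rw [Submodule.mem_orthogonal_singleton_iff_inner_left, ← shift_add]
    exact h _) a
  rwa [Submodule.mem_orthogonal_singleton_iff_inner_left] at h1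

lemma isBesselOn_shift_groupAlgRep {W : Submodule ℂ (L2 n)} {ξ : L2 n}
    (h : IsBesselOn W fun g => shift g ξ) (a : GroupAlg n) :
    IsBesselOn W fun g => shift g (groupAlgRep n a ξ) := by
  induction a using AddMonoidAlgebra.induction_linear with
  | zero => exact ⟨0, le_rfl, fun ξ _ s => by simp⟩
  | add a b ha hb =>
    simp only [map_add, _root_.add_apply]
    exact ha.add hb
  | single k c =>
    have := (h.comp_injective (add_left_injective k)).const_smul c
    simpa only [groupAlgRep_single, map_smul, ← shift_add] using this

end GroupAlgebra

/-! ### The algebra of bi-orthogonal bases of rank two -/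

section RankTwo

variable {n : ℕ} {e₁ e₂ f₁ f₂ φ φ' : compactSuppL2 n}

/-- By duality of the `e_i` and `f_j`, the pairing collapses to `a₁b₁ + a₂b₂` with `a_i = ⟨φ,f_i⟩`,
`b_i = ⟨e_i,φ'⟩`. This is `⟨φ,φ'⟩ = 1` once `φ` is expanded in the `e_i`. -/
lemma algInner_wavelet_self
    (h11 : algInner e₁ f₁ = 1) (h12 : algInner e₁ f₂ = 0) (h21 : algInner e₂ f₁ = 0)
    (h22 : algInner e₂ f₂ = 1)
    (hφ : φ = algInner φ f₁ • e₁ + algInner φ f₂ • e₂) (hone : algInner φ φ' = 1) :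
    algInner (algInner e₂ φ' • e₁ - algInner e₁ φ' • e₂)
      (algInner f₂ φ • f₁ - algInner f₁ φ • f₂) = 1 := by
  have h := congrArg (algInner · φ') hφ
  simp only [algInner_add_left, algInner_smul_left, hone] at h
  simp only [algInner_sub_left, algInner_smul_left, algInner_sub_right, algInner_smul_right,
    groupAlgStar_algInner, h11, h12, h21, h22]
  linear_combination -h

lemma algInner_wavelet_scaling :
    algInner (algInner e₂ φ' • e₁ - algInner e₁ φ' • e₂) φ' = 0 := by
  simp only [algInner_sub_left, algInner_smul_left]
  ring

/-- Cramer's rule for the system expressing `φ` and the wavelet through `e₁, e₂`, whose determinant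
is `-1`. -/
lemma eq_scaling_add_wavelet
    (hφ : φ = algInner φ f₁ • e₁ + algInner φ f₂ • e₂) (hone : algInner φ φ' = 1) :
    e₁ = algInner e₁ φ' • φ + algInner φ f₂ • (algInner e₂ φ' • e₁ - algInner e₁ φ' • e₂) ∧
    e₂ = algInner e₂ φ' • φ +
      (-algInner φ f₁) • (algInner e₂ φ' • e₁ - algInner e₁ φ' • e₂) := by
  have h := congrArg (algInner · φ') hφ
  simp only [algInner_add_left, algInner_smul_left, hone] at h
  constructor
  · linear_combination (norm := module) h • e₁ - algInner e₁ φ' • hφ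
  · linear_combination (norm := module) h • e₂ - algInner e₂ φ' • hφ

end RankTwo

/-! ### Commutation relations for dilations and translations -/

section Dilation

variable {n : ℕ}

lemma shift_dilation {A : GL (Fin n) ℝ} {M : Matrix (Fin n) (Fin n) ℤ}
    (hM : M.map (Int.cast : ℤ → ℝ) = A.1) (k : Fin n → ℤ) (ζ : L2 n) :
    shift k (dilation A ζ) = dilation A (shift (M *ᵥ k) ζ) := by
  apply Lp.ext
  filter_upwards [shift_coe k (dilation A ζ), (measurePreserving_sub_right volume
    (latticePt k)).quasiMeasurePreserving.ae (dilation_coe A ζ),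
    dilation_coe A (shift (M *ᵥ k) ζ),
    (quasiMeasurePreserving_mulVec A).ae (shift_coe (M *ᵥ k) ζ)] with x h1 h2 h3 h4
  rw [h1, h2, h3, h4, latticePt_mulVec, hM, Matrix.mulVec_sub]

lemma dilation_comm {A B : GL (Fin n) ℝ} (hAB : A.1 * B.1 = B.1 * A.1) (ζ : L2 n) :
    dilation A (dilation B ζ) = dilation B (dilation A ζ) := by
  apply Lp.ext
  filter_upwards [dilation_coe A (dilation B ζ), dilation_coe B (dilation A ζ),
    (quasiMeasurePreserving_mulVec A).ae (dilation_coe B ζ),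
    (quasiMeasurePreserving_mulVec B).ae (dilation_coe A ζ)] with x h1 h2 h3 h4
  rw [h1, h2, h3, h4, Matrix.mulVec_mulVec, Matrix.mulVec_mulVec, hAB]
  ring

lemma mem_unitaryImage_one {U : L2 n ≃ₗᵢ[ℂ] L2 n} {V : Submodule ℂ (L2 n)} {ξ : L2 n} :
    ξ ∈ unitaryImage U 1 V ↔ ∃ ζ ∈ V, U ζ = ξ := by
  rw [unitaryImage, zpow_one]
  exact Submodule.mem_map

lemma isClosed_unitaryImage_one {U : L2 n ≃ₗᵢ[ℂ] L2 n} {V : Submodule ℂ (L2 n)}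
    (hV : IsClosed (V : Set (L2 n))) : IsClosed (unitaryImage U 1 V : Set (L2 n)) := by
  rw [unitaryImage, zpow_one]
  exact U.toHomeomorph.isClosedMap _ hV

lemma IsBesselOn.unitaryImage_one {ι : Type*} {V : Submodule ℂ (L2 n)} {x : ι → L2 n}
    (hx : IsBesselOn V x) (U : L2 n ≃ₗᵢ[ℂ] L2 n) :
    IsBesselOn (unitaryImage U 1 V) fun i => U (x i) := by
  obtain ⟨b, hb0, hb⟩ := hx
  refine ⟨b, hb0, fun ξ hξ s => ?_⟩
  obtain ⟨ζ, hζ, rfl⟩ := mem_unitaryImage_one.mp hξ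
  simp only [LinearIsometryEquiv.inner_map_map, LinearIsometryEquiv.norm_map]
  exact hb ζ hζ s

/-- Needed to exclude `V = ⊥`. The unit cube has volume one in every dimension, including zero. -/
instance : Nontrivial (L2 n) := by
  have hK : MeasurableSet (Set.Icc (0 : Fin n → ℝ) 1) := measurableSet_Icc
  have hv : volume (Set.Icc (0 : Fin n → ℝ) 1) = 1 := by
    rw [Real.volume_Icc_pi]
    simp
  refine ⟨indicatorConstLp 2 hK (by simp [hv]) (1 : ℂ), 0, fun h => ?_⟩
  have h1 := congrArg norm h
  rw [norm_indicatorConstLp (by simp) (by simp), Measure.real, hv] at h1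
  simp at h1

end Dilation

/-! ### Multiresolution analyses with one scaling function -/

section MRA

variable {n : ℕ} {A : GL (Fin n) ℝ} {φ φ' : compactSuppL2 n} {V : Submodule ℂ (L2 n)}

lemma IsDualFramesFor.symm {𝓗 ι : Type*} [NormedAddCommGroup 𝓗] [InnerProductSpace ℂ 𝓗]
    {V : Submodule ℂ 𝓗} {x y : ι → 𝓗} (h : IsDualFramesFor V x y) : IsDualFramesFor V y x :=
  ⟨h.frame_dual, h.frame, h.expansion_dual, h.expansion⟩

lemma IsMRA.symm (h : IsMRA A (fun _ : Fin 1 => φ.1) (fun _ : Fin 1 => φ'.1) V) :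
    IsMRA A (fun _ : Fin 1 => φ'.1) (fun _ : Fin 1 => φ.1) V :=
  ⟨h.closed, h.dual.symm, h.le, h.dense, h.inter⟩

lemma IsMRA.shift_mem (h : IsMRA A (fun _ : Fin 1 => φ.1) (fun _ : Fin 1 => φ'.1) V)
    (g : Fin n → ℤ) : shift g φ.1 ∈ V :=
  h.dual.frame.mem (g, 0)

lemma IsMRA.isBesselOn (h : IsMRA A (fun _ : Fin 1 => φ.1) (fun _ : Fin 1 => φ'.1) V) :
    IsBesselOn V fun g => shift g φ.1 :=
  h.dual.frame.isBesselOn.comp_injective (f := fun g => (g, (0 : Fin 1)))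
    fun _ _ hgh => congrArg Prod.fst hgh

lemma hasSum_prod_fin_one {ι E : Type*} [AddCommMonoid E] [TopologicalSpace E] {f : ι → E}
    {a : E} : HasSum (fun p : ι × Fin 1 => f p.1) a ↔ HasSum f a :=
  (Equiv.prodUnique ι (Fin 1)).hasSum_iff

lemma IsMRA.hasSum (h : IsMRA A (fun _ : Fin 1 => φ.1) (fun _ : Fin 1 => φ'.1) V)
    {ξ : L2 n} (hξ : ξ ∈ V) :
    HasSum (fun g => inner ℂ (shift g φ'.1) ξ • shift g φ.1) ξ :=
  hasSum_prod_fin_one.mp (h.dual.expansion_dual ξ hξ)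

lemma IsMRA.eq_zero (h : IsMRA A (fun _ : Fin 1 => φ.1) (fun _ : Fin 1 => φ'.1) V)
    {ξ : L2 n} (hξ : ξ ∈ V) (h0 : ∀ g, inner ℂ (shift g φ'.1) ξ = 0) : ξ = 0 := by
  have h1 := h.hasSum hξ
  simp only [h0, zero_smul] at h1
  exact h1.unique hasSum_zero

/-- Every vector of `V` is a convergent series in the translates of `φ`, and the inner product is
continuous. -/
lemma IsMRA.mem_orthogonal (h : IsMRA A (fun _ : Fin 1 => φ.1) (fun _ : Fin 1 => φ'.1) V)
    {ξ : L2 n} (h0 : ∀ g, inner ℂ (shift g φ.1) ξ = 0) : ξ ∈ Vᗮ := by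
  rw [Submodule.mem_orthogonal']
  intro v hv
  have h1 := (innerSL ℂ ξ).hasSum (h.hasSum hv)
  have h2 : ∀ g, innerSL ℂ ξ (inner ℂ (shift g φ'.1) v • shift g φ.1) = 0 := fun g => by
    rw [map_smul, innerSL_apply_apply, ← inner_conj_symm ξ, h0, map_zero, smul_zero]
  simp only [h2] at h1
  exact h1.unique hasSum_zero

lemma IsMRA.ne_bot (h : IsMRA A (fun _ : Fin 1 => φ.1) (fun _ : Fin 1 => φ'.1) V) :
    V ≠ ⊥ := by
  rintro rfl
  have h1 : (⋃ k : ℤ, (unitaryImage (dilation A) k ⊥ : Set (L2 n))) = {0} := by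
    simp [unitaryImage]
  have h2 := h.dense.closure_eq
  rw [h1, closure_singleton] at h2
  obtain ⟨ξ, hξ⟩ := exists_ne (0 : L2 n)
  have h3 : ξ ∈ ({0} : Set (L2 n)) := by simp [h2]
  exact hξ h3

/-- Compactly supported dual scaling functions are automatically bi-orthogonal, as the group
algebra of `ℤⁿ` has no zero divisors. -/
lemma IsMRA.algInner_eq_one (h : IsMRA A (fun _ : Fin 1 => φ.1) (fun _ : Fin 1 => φ'.1) V) :
    algInner φ φ' = 1 := by
  have hφV : φ.1 ∈ V := by simpa [shift_zero] using h.shift_mem 0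
  have h1 : algInner φ φ' • φ = φ :=
    Subtype.ext ((hasSum_groupAlgRep_algInner φ φ' φ.1).unique (h.hasSum hφV))
  have h2 : algInner φ φ' * algInner φ φ' = algInner φ φ' := by
    rw [← algInner_smul_left, h1]
  -- Cancel the idempotent in a ring without zero divisors. If it were zero, then `φ = 0`, and the
  -- frame property would make `V` trivial.
  refine (mul_eq_right₀ fun h0 => h.ne_bot ?_).mp h2
  rw [h0, zero_smul] at h1
  refine (Submodule.eq_bot_iff V).mpr fun ξ hξ => h.symm.eq_zero hξ fun g => ?_
  rw [← h1]
  simp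

end MRA

/-! ### The wavelets -/

section Wavelet

variable {n : ℕ} {A : GL (Fin n) ℝ} {φ φ' : compactSuppL2 n} {V : Submodule ℂ (L2 n)}
  {M : Matrix (Fin n) (Fin n) ℤ} {g₁ : Fin n → ℤ}

lemma inner_shift_of_algInner_eq_one (h : algInner φ φ' = 1) (g k : Fin n → ℤ) :
    inner ℂ (shift g φ'.1) (shift k φ.1) = if g = k then 1 else 0 := by
  rw [inner_shift_shift, ← coeff_algInner, h, AddMonoidAlgebra.one_def,
    AddMonoidAlgebra.coeff_single, Finsupp.single_apply]
  simp [eq_comm, sub_eq_zero]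

lemma coeff_algInner_dilation (hM : M.map (Int.cast : ℤ → ℝ) = A.1) (h : algInner φ φ' = 1)
    (g k l : Fin n → ℤ) :
    (algInner (dilationC A (shiftC g φ)) (dilationC A (shiftC k φ'))).coeff l =
      if M *ᵥ l + k = g then 1 else 0 := by
  change inner ℂ (shift l (dilation A (shift k φ'.1))) (dilation A (shift g φ.1)) = _
  rw [shift_dilation hM, LinearIsometryEquiv.inner_map_map, ← shift_add,
    inner_shift_of_algInner_eq_one h]

lemma algInner_dilation_self (hM : M.map (Int.cast : ℤ → ℝ) = A.1) (hM0 : M.det ≠ 0)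
    (h : algInner φ φ' = 1) (g : Fin n → ℤ) :
    algInner (dilationC A (shiftC g φ)) (dilationC A (shiftC g φ')) = 1 := by
  ext l
  rw [coeff_algInner_dilation hM h, AddMonoidAlgebra.one_def, AddMonoidAlgebra.coeff_single,
    Finsupp.single_apply]
  refine if_congr ?_ rfl rfl
  rw [add_eq_right]
  exact ⟨fun h0 => (Matrix.eq_zero_of_mulVec_eq_zero hM0 h0).symm, fun h0 => by simp [← h0]⟩

lemma algInner_dilation_of_not_mem (hM : M.map (Int.cast : ℤ → ℝ) = A.1)
    (h : algInner φ φ' = 1) {g k : Fin n → ℤ} (hgk : ¬ ∃ l, M *ᵥ l = g - k) :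
    algInner (dilationC A (shiftC g φ)) (dilationC A (shiftC k φ')) = 0 := by
  ext l
  rw [coeff_algInner_dilation hM h, if_neg fun h0 => hgk ⟨l, eq_sub_of_add_eq h0⟩]
  rfl

lemma shiftC_zero (ζ : compactSuppL2 n) : shiftC 0 ζ = ζ := Subtype.ext (shift_zero ζ.1)

/-- The wavelet as an element of `Λ`. -/
def waveletC (A : GL (Fin n) ℝ) (g₁ : Fin n → ℤ) (φ φ' : compactSuppL2 n) : compactSuppL2 n :=
  algInner (dilationC A (shiftC g₁ φ)) φ' • dilationC A φ -
    algInner (dilationC A φ) φ' • dilationC A (shiftC g₁ φ)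

lemma coe_waveletC : (waveletC A g₁ φ φ').1 = waveletVec A g₁ φ φ' := rfl

lemma shift_dilation_shift_mem (hM : M.map (Int.cast : ℤ → ℝ) = A.1)
    (h : IsMRA A (fun _ : Fin 1 => φ.1) (fun _ : Fin 1 => φ'.1) V) (k g : Fin n → ℤ) :
    shift k (dilation A (shift g φ.1)) ∈ unitaryImage (dilation A) 1 V := by
  rw [shift_dilation hM, ← shift_add]
  exact mem_unitaryImage_one.mpr ⟨_, h.shift_mem _, rfl⟩

/-- These vectors are the `U ν_{Mk+g} φ`, and `k ↦ Mk + g` is injective, so they form a subfamily of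
the image under `U` of a Bessel family. -/
lemma isBesselOn_shift_dilation (hM : M.map (Int.cast : ℤ → ℝ) = A.1) (hM0 : M.det ≠ 0)
    (h : IsMRA A (fun _ : Fin 1 => φ.1) (fun _ : Fin 1 => φ'.1) V) (g : Fin n → ℤ) :
    IsBesselOn (unitaryImage (dilation A) 1 V) fun k => shift k (dilation A (shift g φ.1)) := by
  have h1 := (h.isBesselOn.unitaryImage_one (dilation A)).comp_injective
    ((add_left_injective g).comp (Matrix.mulVec_injective_of_det_ne_zero hM0))
  simpa only [Function.comp_apply, shift_add, ← shift_dilation hM] using h1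

lemma shift_waveletC_mem (hM : M.map (Int.cast : ℤ → ℝ) = A.1)
    (h : IsMRA A (fun _ : Fin 1 => φ.1) (fun _ : Fin 1 => φ'.1) V) (k : Fin n → ℤ) :
    shift k (waveletC A g₁ φ φ').1 ∈ unitaryImage (dilation A) 1 V := by
  have h0 := fun k => shift_dilation_shift_mem hM h k 0
  simp only [shift_zero] at h0
  rw [coe_waveletC, waveletVec, map_sub, shift_groupAlgRep, shift_groupAlgRep]
  refine Submodule.sub_mem _ (groupAlgRep_mem (fun g => ?_) _) (groupAlgRep_mem (fun g => ?_) _)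
  · rw [← shift_add]
    exact h0 _
  · rw [← shift_add]
    exact shift_dilation_shift_mem hM h _ _

lemma isBesselOn_shift_waveletC (hM : M.map (Int.cast : ℤ → ℝ) = A.1) (hM0 : M.det ≠ 0)
    (h : IsMRA A (fun _ : Fin 1 => φ.1) (fun _ : Fin 1 => φ'.1) V) :
    IsBesselOn (unitaryImage (dilation A) 1 V) fun k => shift k (waveletC A g₁ φ φ').1 := by
  have h0 := isBesselOn_shift_dilation hM hM0 h 0
  simp only [shift_zero] at h0
  have h1 := isBesselOn_shift_groupAlgRep h0 (algInner (dilationC A (shiftC g₁ φ)) φ')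
  have h2 := isBesselOn_shift_groupAlgRep (isBesselOn_shift_dilation hM hM0 h g₁)
    (algInner (dilationC A φ) φ')
  simpa only [coe_waveletC, waveletVec, map_sub, sub_eq_add_neg, neg_one_smul, map_add,
    map_neg] using h1.add (h2.const_smul (-1))

lemma shift_waveletC_mem_orthogonal
    (h : IsMRA A (fun _ : Fin 1 => φ.1) (fun _ : Fin 1 => φ'.1) V) (k : Fin n → ℤ) :
    shift k (waveletC A g₁ φ φ').1 ∈ Vᗮ := by
  refine h.symm.mem_orthogonal fun g => ?_
  rw [inner_shift_shift]
  exact (inner_shift_eq_zero_iff _ _).mpr algInner_wavelet_scaling _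

lemma shift_waveletC_mem_waveletSpace (hM : M.map (Int.cast : ℤ → ℝ) = A.1)
    (h : IsMRA A (fun _ : Fin 1 => φ.1) (fun _ : Fin 1 => φ'.1) V) (k : Fin n → ℤ) :
    shift k (waveletC A g₁ φ φ').1 ∈ waveletSpace A V :=
  ⟨shift_waveletC_mem hM h k, shift_waveletC_mem_orthogonal h k⟩

/-- The translates of `U φ'` and `U ν_{g₁} φ'` separate the points of `U V`. -/
lemma eq_zero_of_inner_shift_dilation (hM : M.map (Int.cast : ℤ → ℝ) = A.1)
    (hM2 : M.det.natAbs = 2) (hg₁ : ¬ ∃ k, M *ᵥ k = g₁)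
    (h : IsMRA A (fun _ : Fin 1 => φ.1) (fun _ : Fin 1 => φ'.1) V) {ξ : L2 n}
    (hξ : ξ ∈ unitaryImage (dilation A) 1 V)
    (h0 : ∀ k, inner ℂ (shift k (dilation A φ'.1)) ξ = 0)
    (h1 : ∀ k, inner ℂ (shift k (dilation A (shift g₁ φ'.1))) ξ = 0) : ξ = 0 := by
  obtain ⟨ζ, hζ, rfl⟩ := mem_unitaryImage_one.mp hξ
  rw [h.eq_zero hζ fun g => ?_, map_zero]
  rcases exists_coset_of_natAbs_det_eq_two hM2 hg₁ g with ⟨k, rfl⟩ | ⟨k, rfl⟩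
  · have := h0 k
    rwa [shift_dilation hM, LinearIsometryEquiv.inner_map_map] at this
  · have := h1 k
    rwa [shift_dilation hM, LinearIsometryEquiv.inner_map_map, ← shift_add] at this

/-- Matching translates of `Uφ` and `Uν_{g₁}φ'` would put `g₁` in the range of `M`; hence the
off-diagonal entries vanish. -/
lemma algInner_dilation_table (hM : M.map (Int.cast : ℤ → ℝ) = A.1) (hM0 : M.det ≠ 0)
    (hg₁ : ¬ ∃ k, M *ᵥ k = g₁) (h : algInner φ φ' = 1) :
    algInner (dilationC A φ) (dilationC A φ') = 1 ∧
    algInner (dilationC A φ) (dilationC A (shiftC g₁ φ')) = 0 ∧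
    algInner (dilationC A (shiftC g₁ φ)) (dilationC A φ') = 0 ∧
    algInner (dilationC A (shiftC g₁ φ)) (dilationC A (shiftC g₁ φ')) = 1 := by
  have h1 := algInner_dilation_self hM hM0 h 0
  have h2 := algInner_dilation_of_not_mem hM h (g := 0) (k := g₁) fun ⟨l, hl⟩ =>
    hg₁ ⟨-l, by rw [Matrix.mulVec_neg, hl, zero_sub, neg_neg]⟩
  have h3 := algInner_dilation_of_not_mem hM h (g := g₁) (k := 0) (by rwa [sub_zero])
  simp only [shiftC_zero] at h1 h2 h3
  exact ⟨h1, h2, h3, algInner_dilation_self hM hM0 h g₁⟩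

/-- The two-scale equation. Both sides lie in `UV`, by `V ≤ UV`, and their difference is annihilated
by the translates of `Uφ'` and `Uν_{g₁}φ'`, which separate points there. -/
lemma scaling_eq (hM : M.map (Int.cast : ℤ → ℝ) = A.1)
    (hM2 : M.det.natAbs = 2) (hg₁ : ¬ ∃ k, M *ᵥ k = g₁)
    (h : IsMRA A (fun _ : Fin 1 => φ.1) (fun _ : Fin 1 => φ'.1) V) :
    φ = algInner φ (dilationC A φ') • dilationC A φ +
      algInner φ (dilationC A (shiftC g₁ φ')) • dilationC A (shiftC g₁ φ) := by
  have hM0 : M.det ≠ 0 := fun h0 => by simp [h0] at hM2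
  obtain ⟨h11, h12, h21, h22⟩ := algInner_dilation_table hM hM0 hg₁ h.algInner_eq_one
  rw [← sub_eq_zero]
  refine Subtype.ext (eq_zero_of_inner_shift_dilation hM hM2 hg₁ h ?_
    ((inner_shift_eq_zero_iff _ (dilationC A φ')).mpr ?_)
    ((inner_shift_eq_zero_iff _ (dilationC A (shiftC g₁ φ'))).mpr ?_))
  · have h0 := fun k => shift_dilation_shift_mem hM h k 0
    simp only [shift_zero] at h0
    refine Submodule.sub_mem _ (h.le ?_) (Submodule.add_mem _ (groupAlgRep_mem h0 _)
      (groupAlgRep_mem (fun k => shift_dilation_shift_mem hM h k g₁) _))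
    simpa [shift_zero] using h.shift_mem 0
  · rw [algInner_sub_left, algInner_add_left, algInner_smul_left, algInner_smul_left, h11, h21]
    ring
  · rw [algInner_sub_left, algInner_add_left, algInner_smul_left, algInner_smul_left, h12, h22]
    ring

lemma inner_shift_eq_zero_of_eq_smul_add {ξ : L2 n} {ζ η χ : compactSuppL2 n} {a b : GroupAlg n}
    (hχ : χ = a • ζ + b • η) (hζ : ∀ g, inner ℂ (shift g ζ.1) ξ = 0)
    (hη : ∀ g, inner ℂ (shift g η.1) ξ = 0) (g : Fin n → ℤ) :
    inner ℂ (shift g χ.1) ξ = 0 := by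
  rw [hχ, Submodule.coe_add, map_add, inner_add_left, inner_shift_smul_eq_zero hζ,
    inner_shift_smul_eq_zero hη, add_zero]

/-- The wavelet separates the points of the wavelet space. -/
lemma eq_zero_of_inner_shift_waveletC (hM : M.map (Int.cast : ℤ → ℝ) = A.1)
    (hM2 : M.det.natAbs = 2) (hg₁ : ¬ ∃ k, M *ᵥ k = g₁)
    (h : IsMRA A (fun _ : Fin 1 => φ.1) (fun _ : Fin 1 => φ'.1) V) {ξ : L2 n}
    (hξ : ξ ∈ waveletSpace A V) (h0 : ∀ g, inner ℂ (shift g (waveletC A g₁ φ φ').1) ξ = 0) :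
    ξ = 0 := by
  obtain ⟨h1, h2⟩ := eq_scaling_add_wavelet (scaling_eq hM hM2 hg₁ h) h.algInner_eq_one
  have h3 : ∀ g, inner ℂ (shift g φ.1) ξ = 0 := fun g =>
    (Submodule.mem_orthogonal _ _).mp hξ.2 _ (h.shift_mem g)
  -- Since `Uφ` and `Uν_{g₁}φ` are combinations of `φ` and the wavelet, `ξ` is orthogonal to all
  -- their translates; separation is then used with `φ` and `φ'` exchanged.
  exact eq_zero_of_inner_shift_dilation hM hM2 hg₁ h.symm hξ.1
    (inner_shift_eq_zero_of_eq_smul_add h1 h3 h0) (inner_shift_eq_zero_of_eq_smul_add h2 h3 h0)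

theorem isBiorthogonalWavelets_waveletVec (hM : M.map (Int.cast : ℤ → ℝ) = A.1)
    (hM2 : M.det.natAbs = 2) (hg₁ : ¬ ∃ k, M *ᵥ k = g₁)
    (h : IsMRA A (fun _ : Fin 1 => φ.1) (fun _ : Fin 1 => φ'.1) V) :
    IsBiorthogonalWavelets A V (fun _ : Fin 1 => waveletVec A g₁ φ φ')
      (fun _ : Fin 1 => waveletVec A g₁ φ' φ) := by
  have hM0 : M.det ≠ 0 := fun h0 => by simp [h0] at hM2
  have hW : waveletSpace A V ≤ unitaryImage (dilation A) 1 V := inf_le_left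
  have hfst : Function.Injective (Prod.fst : (Fin n → ℤ) × Fin 1 → Fin n → ℤ) :=
    (Equiv.prodUnique (Fin n → ℤ) (Fin 1)).injective
  obtain ⟨h11, h12, h21, h22⟩ := algInner_dilation_table hM hM0 hg₁ h.algInner_eq_one
  have hself : algInner (waveletC A g₁ φ φ') (waveletC A g₁ φ' φ) = 1 :=
    algInner_wavelet_self h11 h12 h21 h22 (scaling_eq hM hM2 hg₁ h) h.algInner_eq_one
  have hbi := inner_shift_of_algInner_eq_one hself
  refine ⟨fun _ => ?_, fun _ => ?_, IsBiorthogonalFramesFor.of_separating ?_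
    (fun p => shift_waveletC_mem_waveletSpace hM h p.1)
    (fun p => shift_waveletC_mem_waveletSpace hM h.symm p.1)
    (((isBesselOn_shift_waveletC hM hM0 h).mono hW).comp_injective hfst)
    (((isBesselOn_shift_waveletC hM hM0 h.symm).mono hW).comp_injective hfst)
    (fun p => (hbi p.1 p.1).trans (if_pos rfl))
    (fun p q hpq => (hbi q.1 p.1).trans (if_neg fun h0 => hpq (hfst h0.symm)))
    (fun ξ hξ h0 => eq_zero_of_inner_shift_waveletC hM hM2 hg₁ h hξ fun g => h0 (g, 0))
    (fun ξ hξ h0 => eq_zero_of_inner_shift_waveletC hM hM2 hg₁ h.symm hξ fun g => h0 (g, 0))⟩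
  · simpa [shift_zero, coe_waveletC] using shift_waveletC_mem (g₁ := g₁) hM h 0
  · simpa [shift_zero, coe_waveletC] using shift_waveletC_mem (g₁ := g₁) hM h.symm 0
  · exact (isClosed_unitaryImage_one h.closed).inter (Submodule.isClosed_orthogonal V)

end Wavelet

/-! ### Symmetry of the wavelets -/

section Symmetry

variable {n : ℕ} {A : GL (Fin n) ℝ} {φ φ' : compactSuppL2 n} {g₁ : Fin n → ℤ}

/-- Reindex the sum by `σ`: the coefficients do not change, and `E` undoes `σ` on the translates. -/
lemma groupAlgRep_algInner_fixed (E : L2 n →L[ℂ] L2 n) (σ : (Fin n → ℤ) ≃ (Fin n → ℤ))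
    {ξ η : compactSuppL2 n} {ζ : L2 n}
    (hc : ∀ g, inner ℂ (shift (σ g) η.1) ξ.1 = inner ℂ (shift g η.1) ξ.1)
    (hE : ∀ g, E (shift (σ g) ζ) = shift g ζ) :
    E (groupAlgRep n (algInner ξ η) ζ) = groupAlgRep n (algInner ξ η) ζ := by
  have h1 := E.hasSum (hasSum_groupAlgRep_algInner ξ η ζ)
  rw [← σ.hasSum_iff] at h1
  refine h1.unique ?_
  convert hasSum_groupAlgRep_algInner ξ η ζ using 2 with g
  rw [Function.comp_apply, map_smul, hc, hE]

/-- An integer matrix regarded as an element of `GL_n(ℝ)`. -/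
def realGL (h : GL (Fin n) ℤ) : GL (Fin n) ℝ :=
  Matrix.GeneralLinearGroup.map (Int.castRingHom ℝ) h

lemma coe_realGL (h : GL (Fin n) ℤ) : (realGL h).1 = realMatrix h := rfl

lemma abs_det_realGL (h : GL (Fin n) ℤ) : |(realGL h).1.det| = 1 := by
  have h1 : (realGL h).1.det = (h.1.det : ℝ) := by
    rw [coe_realGL, realMatrix]
    exact (Int.cast_det h.1).symm
  have h2 : |h.1.det| = 1 := Int.isUnit_iff_abs_eq.mp ((Matrix.isUnit_iff_isUnit_det _).mp h.isUnit)
  rw [h1]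
  exact_mod_cast h2

lemma dilation_realGL_coe (h : GL (Fin n) ℤ) (ζ : L2 n) :
    ∀ᵐ x, dilation (realGL h) ζ x = ζ (realMatrix h *ᵥ x) := by
  filter_upwards [dilation_coe (realGL h) ζ] with x hx
  rw [hx, abs_det_realGL, Real.sqrt_one, Complex.ofReal_one, one_mul, coe_realGL]

lemma dilation_realGL_shift (h : GL (Fin n) ℤ) (g : Fin n → ℤ) (ζ : L2 n) :
    dilation (realGL h) (shift (h.1 *ᵥ g) ζ) = shift g (dilation (realGL h) ζ) :=
  (shift_dilation (A := realGL h) (M := h.1) rfl g ζ).symm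

/-- The bijection of `ℤⁿ` given by an element of `GL_n(ℤ)`. -/
def mulVecEquiv (h : GL (Fin n) ℤ) : (Fin n → ℤ) ≃ (Fin n → ℤ) where
  toFun g := h.1 *ᵥ g
  invFun g := h⁻¹.1 *ᵥ g
  left_inv g := by
    change h⁻¹.1 *ᵥ (h.1 *ᵥ g) = g
    rw [Matrix.mulVec_mulVec, ← Units.val_mul, inv_mul_cancel, Units.val_one, Matrix.one_mulVec]
  right_inv g := by
    change h.1 *ᵥ (h⁻¹.1 *ᵥ g) = g
    rw [Matrix.mulVec_mulVec, ← Units.val_mul, mul_inv_cancel, Units.val_one, Matrix.one_mulVec]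

/-- Let `D` be composition with `h`. It fixes `Uφ`, while `Dν_k` fixes `Uν_{g₁}φ` because `Ak + g₁ =
hg₁`. In the term acting on `Uφ` the index moves by `g ↦ hg - k`, in the other by `g ↦ hg`. -/
lemma dilation_realGL_shift_waveletVec {M : Matrix (Fin n) (Fin n) ℤ}
    (hM : M.map (Int.cast : ℤ → ℝ) = A.1) (h : GL (Fin n) ℤ)
    (hcomm : realMatrix h * A.1 = A.1 * realMatrix h) {k : Fin n → ℤ}
    (hk : M *ᵥ k + g₁ = h.1 *ᵥ g₁) (hφ : dilation (realGL h) φ.1 = φ.1)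
    (hφ' : dilation (realGL h) φ'.1 = φ'.1) :
    dilation (realGL h) (shift k (waveletVec A g₁ φ φ')) = waveletVec A g₁ φ φ' := by
  set D := dilation (realGL h)
  have hD : ∀ g (ζ : L2 n), D (shift (h.1 *ᵥ g) ζ) = shift g (D ζ) := dilation_realGL_shift h
  have hDU : ∀ ζ : L2 n, D (dilation A ζ) = dilation A (D ζ) := dilation_comm hcomm
  have hU1 : D (dilation A φ.1) = dilation A φ.1 := by rw [hDU, hφ]
  have hU2 : D (shift k (dilation A (shift g₁ φ.1))) = dilation A (shift g₁ φ.1) := by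
    rw [shift_dilation hM, ← shift_add, hk, hDU, hD, hφ]
  let E : L2 n →L[ℂ] L2 n :=
    D.toContinuousLinearEquiv.toContinuousLinearMap ∘L (shift k).toContinuousLinearMap
  have hEdef : ∀ ζ, E ζ = D (shift k ζ) := fun _ => rfl
  rw [← hEdef, waveletVec, map_sub,
    groupAlgRep_algInner_fixed E ((mulVecEquiv h).trans (Equiv.subRight k)) (fun g => ?_)
      (fun g => ?_),
    groupAlgRep_algInner_fixed E (mulVecEquiv h) (fun g => ?_) (fun g => ?_)]
  · change inner ℂ (shift (h.1 *ᵥ g) φ'.1) (dilation A φ.1) =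
      inner ℂ (shift g φ'.1) (dilation A φ.1)
    rw [← D.inner_map_map, hD, hφ', hU1]
  · change D (shift k (shift (h.1 *ᵥ g) (dilation A (shift g₁ φ.1)))) = _
    rw [shift_comm, hD, hU2]
  · change inner ℂ (shift (h.1 *ᵥ g - k) φ'.1) (dilation A (shift g₁ φ.1)) =
      inner ℂ (shift g φ'.1) (dilation A (shift g₁ φ.1))
    rw [← (shift k).inner_map_map, ← D.inner_map_map, ← shift_add, add_sub_cancel, hD, hφ', hU2]
  · change D (shift k (shift (h.1 *ᵥ g - k) (dilation A φ.1))) = _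
    rw [← shift_add, add_sub_cancel, hD, hU1]

lemma waveletVec_symmetric {M : Matrix (Fin n) (Fin n) ℤ}
    (hM : M.map (Int.cast : ℤ → ℝ) = A.1) {H : Subgroup (GL (Fin n) ℤ)}
    (hH : IsAffiliated H A) {h : GL (Fin n) ℤ} (hh : h ∈ H)
    (hφ : ∀ᵐ x, φ.1 (realMatrix h *ᵥ x) = φ.1 x)
    (hφ' : ∀ᵐ x, φ'.1 (realMatrix h *ᵥ x) = φ'.1 x) :
    ∀ᵐ x : Fin n → ℝ, waveletVec A g₁ φ φ' (realMatrix h *ᵥ x + A.1⁻¹ *ᵥ latticePt g₁) =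
      waveletVec A g₁ φ φ' (x + A.1⁻¹ *ᵥ latticePt g₁) := by
  have hfix : ∀ ζ : L2 n, (∀ᵐ x, ζ (realMatrix h *ᵥ x) = ζ x) → dilation (realGL h) ζ = ζ := by
    intro ζ hζ
    apply Lp.ext
    filter_upwards [hζ, dilation_realGL_coe h ζ] with x h1 h2
    rw [h2, h1]
  have hcomm := hH.comm h hh
  obtain ⟨k, hk⟩ := hH.trivial_on_quotient h hh g₁
  have hdet : IsUnit A.1.det := (Matrix.isUnit_iff_isUnit_det _).mp A.isUnit
  have hk' : M *ᵥ k + g₁ = h.1 *ᵥ g₁ := by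
    apply latticePt_injective
    rw [latticePt_add, latticePt_mulVec, latticePt_mulVec, hM, ← hk, Matrix.sub_mulVec,
      Matrix.one_mulVec, sub_add_cancel]
    rfl
  -- The point `A⁻¹g₁` is fixed by `x ↦ hx - k`, since `h` commutes with `A⁻¹` and `hg₁ - g₁ = Ak`.
  have hpt : realMatrix h *ᵥ (A.1⁻¹ *ᵥ latticePt g₁) - latticePt k = A.1⁻¹ *ᵥ latticePt g₁ := by
    have hc : realMatrix h * A.1⁻¹ = A.1⁻¹ * realMatrix h := by
      calc realMatrix h * A.1⁻¹ = A.1⁻¹ * (A.1 * realMatrix h) * A.1⁻¹ := by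
            rw [← mul_assoc, Matrix.nonsing_inv_mul _ hdet, one_mul]
        _ = A.1⁻¹ * realMatrix h := by
            rw [← hcomm, ← mul_assoc, mul_assoc, Matrix.mul_nonsing_inv _ hdet, mul_one]
    have hkA : latticePt k = A.1⁻¹ *ᵥ (A.1 *ᵥ latticePt k) := by
      rw [Matrix.mulVec_mulVec, Matrix.nonsing_inv_mul _ hdet, Matrix.one_mulVec]
    rw [hkA, ← hk, Matrix.mulVec_mulVec, hc, ← Matrix.mulVec_mulVec, ← Matrix.mulVec_sub,
      Matrix.sub_mulVec, Matrix.one_mulVec, sub_sub_cancel]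
  have hmain := dilation_realGL_shift_waveletVec hM h hcomm hk' (hfix _ hφ) (hfix _ hφ')
  have hae : ∀ᵐ x, waveletVec A g₁ φ φ' (realMatrix h *ᵥ x - latticePt k) =
      waveletVec A g₁ φ φ' x := by
    filter_upwards [dilation_realGL_coe h (shift k (waveletVec A g₁ φ φ')),
      (quasiMeasurePreserving_mulVec (realGL h)).ae (shift_coe k (waveletVec A g₁ φ φ'))]
      with x h1 h2
    rw [hmain] at h1
    rw [h1]
    exact h2.symm
  -- Move the origin to the fixed point: the affine symmetry becomes the linear one.
  filter_upwards [(measurePreserving_add_right volume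
    (A.1⁻¹ *ᵥ latticePt g₁)).quasiMeasurePreserving.ae hae] with x hx
  rw [← hx, Matrix.mulVec_add, add_sub_assoc, hpt]

end Symmetry

end

theorem mainTheorem7 {n : ℕ} (A : GL (Fin n) ℝ) (hA : IsDilationMatrix A)
    (hdet : |A.1.det| = 2) (φ φ' : compactSuppL2 n) (V : Submodule ℂ (L2 n))
    (hMRA : IsMRA A (fun _ : Fin 1 => φ.1) (fun _ : Fin 1 => φ'.1) V)
    (g₁ : Fin n → ℤ) (hg₁ : ¬ ∃ g : Fin n → ℤ, A.1 *ᵥ latticePt g = latticePt g₁) :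
    (waveletVec A g₁ φ φ' ∈ compactSuppL2 n ∧
      waveletVec A g₁ φ' φ ∈ compactSuppL2 n ∧
      IsBiorthogonalWavelets A V (fun _ : Fin 1 => waveletVec A g₁ φ φ')
        (fun _ : Fin 1 => waveletVec A g₁ φ' φ)) ∧
    ∀ H : Subgroup (GL (Fin n) ℤ), IsAffiliated H A →
      (∀ h ∈ H, ∀ᵐ x : Fin n → ℝ, φ.1 (realMatrix h *ᵥ x) = φ.1 x) →
      (∀ h ∈ H, ∀ᵐ x : Fin n → ℝ, φ'.1 (realMatrix h *ᵥ x) = φ'.1 x) →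
      ∀ h ∈ H, ∀ᵐ x : Fin n → ℝ,
        waveletVec A g₁ φ φ' (realMatrix h *ᵥ x + A.1⁻¹ *ᵥ latticePt g₁) =
            waveletVec A g₁ φ φ' (x + A.1⁻¹ *ᵥ latticePt g₁) ∧
          waveletVec A g₁ φ' φ (realMatrix h *ᵥ x + A.1⁻¹ *ᵥ latticePt g₁) =
            waveletVec A g₁ φ' φ (x + A.1⁻¹ *ᵥ latticePt g₁) := by
  obtain ⟨M, hM⟩ := hA.exists_int
  have hM2 : M.det.natAbs = 2 := by
    have h1 : A.1.det = (M.det : ℝ) := by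
      rw [← hM]
      exact (Int.cast_det M).symm
    rw [h1] at hdet
    have h2 : |M.det| = 2 := by exact_mod_cast hdet
    rw [Int.abs_eq_natAbs] at h2
    exact_mod_cast h2
  have hg : ¬ ∃ k, M *ᵥ k = g₁ := fun ⟨k, hk⟩ =>
    hg₁ ⟨k, by rw [← hM, ← latticePt_mulVec, hk]⟩
  refine ⟨⟨(waveletC A g₁ φ φ').2, (waveletC A g₁ φ' φ).2,
    isBiorthogonalWavelets_waveletVec hM hM2 hg hMRA⟩, fun H hH hφ hφ' h hh => ?_⟩
  filter_upwards [waveletVec_symmetric (g₁ := g₁) hM hH hh (hφ h hh) (hφ' h hh),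
    waveletVec_symmetric (g₁ := g₁) hM hH hh (hφ' h hh) (hφ h hh)] with x h1 h2
  exact ⟨h1, h2⟩
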